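/- For a set $\mathcal X$ and a class $\mathcal F$ of functions $\mathcal X\to\mathbb R$ let \[ \mathcal R_m(\mathcal F)=\sup_{x_1,\dots,x_m\in\mathcal X}\ \mathbb E_{\boldsymbol\epsilon}\Big[\sup_{f\in\mathcal F}\frac1m\sum_{i=1}^m\epsilon_i f(x_i)\Big] \] be its Rademacher complexity on $m$ inputs from $\mathcal X$, where $\epsilon_1,\dots,\epsilon_m$ are independent and uniform on $\{-1,+1\}$. For $\sigma:\mathbb R\to\mathbb R$ (applied entrywise to vectors) let \[ \mathcal F^{\sigma}_{b,B,n,d}=\{\mathbf x\mapsto \mathbf u^\top\sigma(W\mathbf x)\ :\ \mathbf u\in\mathbb R^n,\ W\in\mathbb R^{n\times d},\ \|\mathbf u\|\le b,\ \|W\|_F\le B\}, \] where $\|\cdot\|$ is the Euclidean norm and $\|\cdot\|_F$ the Frobenius norm. There is a universal constant $c>0$ such that the following holds. Suppose $\sigma:\mathbb R\to\mathbb R$ is $L$-Lipschitz and $\sigma(0)=0$. Then for all real $b,B,b_x,\epsilon>0$ and all integers $n,d,m\ge 1$, the Rademacher complexity of $\mathcal F^{\sigma}_{b,B,n,d}$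 on $m$ inputs from $\{\mathbf x\in\mathbb R^d:\|\mathbf x\|\le b_x\}$ is at most $\epsilon$ if \[ m\ \ge\ c\cdot\frac{(bBb_xL)^2\,(1+\log^3 m)}{\epsilon^2}. \] Consequently, $m=\tilde{\mathcal O}\big((bBb_xL/\epsilon)^2\big)$ suffices: there is a universal constant $C>0$ such that, in the same setting and with $K=(bBb_xL/\epsilon)^2$, the Rademacher complexity is at most $\epsilon$ for every integer $m\ge1$ with $m\ge C\,K\,(1+\log^3(1+K))$. Both conditions are independent of the width $n$ and the dimension $d$. -/

import Mathlib

open scoped NNReal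

noncomputable section

/-- The Rademacher complexity `R_m(F)` of a class `F` of real functions over `m` inputs from `X`:
the supremum over `x_1, …, x_m ∈ X` of the average, over all `2 ^ m` sign vectors `s ∈ {-1, 1}^m`,
of `sup_{f ∈ F} (1/m) ∑ i, s_i f(x_i)`. The suprema are taken in the extended reals, so they are
genuine suprema also when they are infinite. -/
def rademacherComplexity {E : Type*} (m : ℕ) (X : Set E) (F : Set (E → ℝ)) : EReal :=
  ⨆ x : Fin m → X,
    (((2 ^ m : ℝ)⁻¹ : ℝ) : EReal) *
      ∑ s : Fin m → ℤˣ,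
        ⨆ f ∈ F, (((1 / (m : ℝ)) * ∑ i, ((s i : ℤ) : ℝ) * f (x i) : ℝ) : EReal)

/-- The one-hidden-layer network `x ↦ uᵀ σ(W x)`, with `σ` applied entrywise. -/
def oneHiddenLayer {n d : ℕ} (σ : ℝ → ℝ) (u : EuclideanSpace ℝ (Fin n))
    (W : Matrix (Fin n) (Fin d) ℝ) (x : EuclideanSpace ℝ (Fin d)) : ℝ :=
  ∑ j, u j * σ (W.mulVec x.ofLp j)

section Frobenius

open scoped Matrix.Norms.Frobenius

/-- The networks `x ↦ uᵀ σ(W x)` of width `n` on `ℝ^d` with Euclidean norm `‖u‖ ≤ b` and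
Frobenius norm `‖W‖_F ≤ B`. -/
def frobeniusClass (σ : ℝ → ℝ) (b B : ℝ) (n d : ℕ) : Set (EuclideanSpace ℝ (Fin d) → ℝ) :=
  {f | ∃ (u : EuclideanSpace ℝ (Fin n)) (W : Matrix (Fin n) (Fin d) ℝ),
    ‖u‖ ≤ b ∧ ‖W‖ ≤ B ∧ f = oneHiddenLayer σ u W}

end Frobenius

end

/-! ### Averages over sign vectors -/

/-! Fix the signs `s` and write `w_j` for the rows of `W`. Exchanging sums, `∑ i, s_i uᵀσ(W x_i) = ∑
j, u_j ∑ i, s_i σ⟨w_j, x_i⟩`. If each inner sum is at most `‖w_j‖` times a quantity depending only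
on `s` and the inputs, Cauchy–Schwarz gives `∑ j, |u_j| ‖w_j‖ ≤ b B` and the width disappears.
Normalising `w_j` moves its norm into the Lipschitz constant but changes the activation from row to
row, so the bound must be uniform over all Lipschitz `h` with `h 0 = 0` and over all `v` in the unit
ball (`sum_lipschitz_ridge_le`).

To get this, `h` is expanded in dyadic triangle waves (the Faber–Schauder system). Level `k` has
coefficients at most `L / 2 ^ (k + 1)`, and the signed sum is linear in them, so it is enough to
treat coefficients `±1`, of which there are only `exp (O(2 ^ k))` choices. For one choice the wave
is `2 * 2 ^ k`-Lipschitz, and contraction bounds the mean supremum over `v` by `2 ^ k * √m`;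
concentration under bounded differences makes the maximum over all choices of the same order
(`average_waveMax_le`). Each level thus costs `O(L √m)`, and about `log m` levels leave a negligible
remainder. The complexity is at most `8 b B b_x L (1 + log m) / √m`. -/

theorem sum_signs_succ {m : ℕ} (F : (Fin (m + 1) → ℤˣ) → ℝ) :
    ∑ s, F s = ∑ s : Fin m → ℤˣ, (F (Fin.cons 1 s) + F (Fin.cons (-1) s)) := by
  rw [← (Fin.consEquiv (fun _ => ℤˣ)).sum_comp, Fintype.sum_prod_type, Finset.sum_comm]
  refine Finset.sum_congr rfl fun s _ => ?_
  have : (Finset.univ : Finset ℤˣ) = {1, -1} := by decide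
  rw [this, Finset.sum_pair (by decide)]
  rfl

theorem abs_sign (s : ℤˣ) : |((s : ℤ) : ℝ)| = 1 := by
  rcases Int.units_eq_one_or s with rfl | rfl <;> simp

theorem card_signs (m : ℕ) : (Fintype.card (Fin m → ℤˣ) : ℝ) = 2 ^ m := by
  simp

/-- The second moment of a Rademacher sum in an inner product space. -/
theorem sum_signs_norm_sq {E : Type*} [NormedAddCommGroup E] [InnerProductSpace ℝ E] {m : ℕ}
    (y : Fin m → E) (z : E) :
    ∑ s : Fin m → ℤˣ, ‖z + ∑ i, ((s i : ℤ) : ℝ) • y i‖ ^ 2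
      = 2 ^ m * (‖z‖ ^ 2 + ∑ i, ‖y i‖ ^ 2) := by
  induction m generalizing z with
  | zero => simp
  | succ m ih =>
    rw [sum_signs_succ, Finset.sum_add_distrib]
    simp only [Fin.sum_univ_succ, Fin.cons_zero, Fin.cons_succ, ← add_assoc]
    rw [ih (fun i => y i.succ), ih (fun i => y i.succ)]
    have h := parallelogram_law_with_norm ℝ z (y 0)
    simp only [Units.val_one, Int.cast_one, one_smul, Units.val_neg, Int.cast_neg, neg_smul,
      ← sub_eq_add_neg]
    rw [pow_succ]
    linear_combination (2 : ℝ) ^ m * h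

/-- Cauchy–Schwarz over the sign vectors reduces the first moment to the second. -/
theorem sum_signs_norm_le {E : Type*} [NormedAddCommGroup E] [InnerProductSpace ℝ E] {m : ℕ}
    (y : Fin m → E) {r : ℝ} (hr : 0 ≤ r) (hy : ∀ i, ‖y i‖ ≤ r) :
    ∑ s : Fin m → ℤˣ, ‖∑ i, ((s i : ℤ) : ℝ) • y i‖ ≤ 2 ^ m * (r * √m) := by
  have h := sum_signs_norm_sq y 0
  simp only [zero_add, norm_zero, ne_eq, OfNat.ofNat_ne_zero, not_false_eq_true, zero_pow] at h
  refine abs_le_of_sq_le_sq' ?_ (by positivity) |>.2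
  refine (sq_sum_le_card_mul_sum_sq).trans ?_
  rw [h, Finset.card_univ, card_signs]
  have : ∑ i, ‖y i‖ ^ 2 ≤ m * r ^ 2 := by
    refine (Finset.sum_le_sum fun i _ => pow_le_pow_left₀ (norm_nonneg _) (hy i) 2).trans ?_
    simp
  calc (2 : ℝ) ^ m * (2 ^ m * ∑ i, ‖y i‖ ^ 2) ≤ 2 ^ m * (2 ^ m * (m * r ^ 2)) := by gcongr
    _ = _ := by rw [mul_pow, mul_pow, Real.sq_sqrt (Nat.cast_nonneg m)]; ring

/-! ### The contraction principle -/

/-- One coordinate of the contraction principle: the two suprema average over one sign. -/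
theorem iSup_add_iSup_sub_le {T : Type*} [Nonempty T] (a f g : T → ℝ)
    (hp : BddAbove (Set.range fun t => a t + f t)) (hm : BddAbove (Set.range fun t => a t - f t))
    (hfg : ∀ t t', |g t - g t'| ≤ |f t - f t'|) :
    (⨆ t, (a t + g t)) + ⨆ t, (a t - g t) ≤ (⨆ t, (a t + f t)) + ⨆ t, (a t - f t) := by
  have key : ∀ t t', (a t + g t) + (a t' - g t') ≤ (⨆ t, (a t + f t)) + ⨆ t, (a t - f t) := by
    intro t t'
    have h1 := le_ciSup hp t
    have h2 := le_ciSup hm t'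
    have h3 := le_ciSup hp t'
    have h4 := le_ciSup hm t
    have h5 := (le_abs_self _).trans (hfg t t')
    -- The sign of `f t - f t'` decides which of `t`, `t'` is used in which supremum on the right.
    rcases abs_cases (f t - f t') with ⟨h, _⟩ | ⟨h, _⟩ <;> linarith
  rw [← le_sub_iff_add_le]
  refine ciSup_le fun t => ?_
  rw [le_sub_comm]
  refine ciSup_le fun t' => ?_
  linarith [key t t']

theorem bddAbove_range_of_abs_le {T : Type*} {a : T → ℝ} (h : ∃ C, ∀ t, |a t| ≤ C) :
    BddAbove (Set.range a) := by
  obtain ⟨C, hC⟩ := h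
  exact ⟨C, by rintro _ ⟨t, rfl⟩; exact (le_abs_self _).trans (hC t)⟩

theorem exists_abs_signed_sum_le {T : Type*} {m : ℕ} {f : Fin m → T → ℝ}
    (hf : ∀ i, ∃ C, ∀ t, |f i t| ≤ C) (s : Fin m → ℤˣ) :
    ∃ C, ∀ t, |∑ i, ((s i : ℤ) : ℝ) * f i t| ≤ C := by
  choose C hC using hf
  refine ⟨∑ i, C i, fun t => (Finset.abs_sum_le_sum_abs _ _).trans ?_⟩
  refine Finset.sum_le_sum fun i _ => ?_
  rw [abs_mul, abs_sign, one_mul]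
  exact hC i t

theorem exists_abs_add_le {T : Type*} {f g : T → ℝ} (hf : ∃ C, ∀ t, |f t| ≤ C)
    (hg : ∃ C, ∀ t, |g t| ≤ C) : ∃ C, ∀ t, |f t + g t| ≤ C := by
  obtain ⟨C, hC⟩ := hf
  obtain ⟨D, hD⟩ := hg
  exact ⟨C + D, fun t => (abs_add_le _ _).trans (add_le_add (hC t) (hD t))⟩

theorem exists_abs_sub_le {T : Type*} {f g : T → ℝ} (hf : ∃ C, ∀ t, |f t| ≤ C)
    (hg : ∃ C, ∀ t, |g t| ≤ C) : ∃ C, ∀ t, |f t - g t| ≤ C := by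
  simp_rw [sub_eq_add_neg]
  exact exists_abs_add_le hf (by simpa only [abs_neg] using hg)

/-- The Ledoux–Talagrand contraction principle, for bounded processes. -/
theorem sum_signs_iSup_le_of_contraction {T : Type*} [Nonempty T] {m : ℕ} (a : T → ℝ)
    (f g : Fin m → T → ℝ) (ha : ∃ C, ∀ t, |a t| ≤ C) (hf : ∀ i, ∃ C, ∀ t, |f i t| ≤ C)
    (hg : ∀ i, ∃ C, ∀ t, |g i t| ≤ C)
    (hfg : ∀ i t t', |g i t - g i t'| ≤ |f i t - f i t'|) :
    ∑ s : Fin m → ℤˣ, ⨆ t, (a t + ∑ i, ((s i : ℤ) : ℝ) * g i t)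
      ≤ ∑ s : Fin m → ℤˣ, ⨆ t, (a t + ∑ i, ((s i : ℤ) : ℝ) * f i t) := by
  induction m generalizing a with
  | zero => simp
  | succ m ih =>
    rw [sum_signs_succ, sum_signs_succ]
    simp only [Fin.sum_univ_succ, Fin.cons_zero, Fin.cons_succ, ← add_assoc, Units.val_one,
      Int.cast_one, one_mul, Units.val_neg, Int.cast_neg, neg_mul, ← sub_eq_add_neg]
    rw [Finset.sum_add_distrib]
    -- The term of the first sign is absorbed into `a`. The later coordinates are contracted first,
    -- then the first one with the other signs fixed.
    have hp := ih (fun t => a t + g 0 t) (fun i => f i.succ) (fun i => g i.succ)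
      (exists_abs_add_le ha (hg 0)) (fun i => hf _) (fun i => hg _) (fun i => hfg _)
    have hm := ih (fun t => a t - g 0 t) (fun i => f i.succ) (fun i => g i.succ)
      (exists_abs_sub_le ha (hg 0)) (fun i => hf _) (fun i => hg _) (fun i => hfg _)
    refine (add_le_add hp hm).trans ?_
    rw [← Finset.sum_add_distrib]
    refine Finset.sum_le_sum fun s _ => ?_
    have hb := exists_abs_add_le ha (exists_abs_signed_sum_le (fun i => hf (Fin.succ i)) s)
    have := iSup_add_iSup_sub_le (fun t => a t + ∑ i, ((s i : ℤ) : ℝ) * f i.succ t) (f 0) (g 0)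
      (bddAbove_range_of_abs_le (exists_abs_add_le hb (hf 0)))
      (bddAbove_range_of_abs_le (exists_abs_sub_le hb (hf 0))) (hfg 0)
    simpa only [add_right_comm, add_sub_right_comm] using this

/-! ### Bounded differences and maximal inequalities -/

/-- The exponential moment bound for functions of signs with bounded differences. -/
theorem sum_signs_exp_le {m : ℕ} (F : (Fin m → ℤˣ) → ℝ)
    (hF : ∀ s s' i, (∀ j, j ≠ i → s j = s' j) → |F s - F s'| ≤ 2) (l : ℝ) :
    ∑ s, Real.exp (l * F s)
      ≤ 2 ^ m * Real.exp (l * ((2 ^ m)⁻¹ * ∑ s, F s) + l ^ 2 * m / 2) := by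
  induction m with
  | zero => simp
  | succ m ih =>
    -- Averaging out one sign preserves bounded differences; each such step costs a factor `exp (l ^
    -- 2 / 2)`, by Hoeffding's `cosh` bound.
    set G : (Fin m → ℤˣ) → ℝ := fun s => (F (Fin.cons 1 s) + F (Fin.cons (-1) s)) / 2 with hG
    have hGd : ∀ s s' i, (∀ j, j ≠ i → s j = s' j) → |G s - G s'| ≤ 2 := by
      intro s s' i h
      have aux : ∀ e : ℤˣ, |F (Fin.cons e s) - F (Fin.cons e s')| ≤ 2 := by
        intro e
        refine hF _ _ i.succ fun j hj => ?_
        cases j using Fin.cases with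
        | zero => rfl
        | succ j => simpa using h j (fun hh => hj (by rw [hh]))
      have h1 := abs_le.1 (aux 1)
      have h2 := abs_le.1 (aux (-1))
      rw [abs_le, hG]
      constructor <;> dsimp only <;> linarith [h1.1, h1.2, h2.1, h2.2]
    have hsum : ∑ s, F s = 2 * ∑ s, G s := by
      rw [sum_signs_succ, Finset.mul_sum]
      refine Finset.sum_congr rfl fun s _ => ?_
      simp only [hG]; ring
    have hpt : ∀ s : Fin m → ℤˣ,
        Real.exp (l * F (Fin.cons 1 s)) + Real.exp (l * F (Fin.cons (-1) s))
          ≤ 2 * Real.exp (l ^ 2 / 2) * Real.exp (l * G s) := by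
      intro s
      set D := (F (Fin.cons 1 s) - F (Fin.cons (-1) s)) / 2 with hD
      have hD1 : |D| ≤ 1 := by
        have := abs_le.1 (hF (Fin.cons 1 s) (Fin.cons (-1) s) 0 (fun j hj => by
          cases j using Fin.cases with
          | zero => exact absurd rfl hj
          | succ j => rfl))
        rw [abs_le]
        constructor <;> linarith [this.1, this.2]
      have e1 : l * F (Fin.cons 1 s) = l * G s + l * D := by simp only [hG, hD]; ring
      have e2 : l * F (Fin.cons (-1) s) = l * G s + -(l * D) := by simp only [hG, hD]; ring
      rw [e1, e2, Real.exp_add, Real.exp_add]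
      have hc : Real.cosh (l * D) ≤ Real.exp (l ^ 2 / 2) := by
        refine (Real.cosh_le_exp_half_sq _).trans (Real.exp_le_exp.2 ?_)
        have : D ^ 2 ≤ 1 := (sq_le_one_iff_abs_le_one D).2 hD1
        nlinarith [sq_nonneg l]
      rw [Real.cosh_eq] at hc
      nlinarith [Real.exp_pos (l * G s)]
    rw [sum_signs_succ, hsum]
    refine (Finset.sum_le_sum fun s _ => hpt s).trans ?_
    rw [← Finset.mul_sum]
    refine (mul_le_mul_of_nonneg_left (ih G hGd) (by positivity)).trans (le_of_eq ?_)
    have e : l * ((2 ^ (m + 1))⁻¹ * (2 * ∑ s, G s)) + l ^ 2 * ((m + 1 : ℕ) : ℝ) / 2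
        = l ^ 2 / 2 + (l * ((2 ^ m)⁻¹ * ∑ s, G s) + l ^ 2 * m / 2) := by
      rw [pow_succ]; push_cast; field_simp; ring
    rw [e, Real.exp_add _ (l * _ + _), pow_succ]
    ring

/-- The maximal inequality for finitely many functions of signs with bounded differences. -/
theorem sum_signs_iSup_le_of_bounded_differences {Θ : Type*} [Fintype Θ] [Nonempty Θ] {m : ℕ}
    (F : Θ → (Fin m → ℤˣ) → ℝ)
    (hF : ∀ θ s s' i, (∀ j, j ≠ i → s j = s' j) → |F θ s - F θ s'| ≤ 2) {μ q l : ℝ} (hl : 0 < l)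
    (hμ : ∀ θ, (2 ^ m)⁻¹ * ∑ s, F θ s ≤ μ) (hq : (Fintype.card Θ : ℝ) ≤ Real.exp q) :
    (2 ^ m)⁻¹ * ∑ s, ⨆ θ, F θ s ≤ μ + q / l + l * m / 2 := by
  set a := q + (l * μ + l ^ 2 * m / 2) with ha
  -- The tangent line `x + 1 ≤ exp x` at `x = l * F θ s - a` replaces Jensen's inequality; `a`
  -- bounds the logarithm of the mean of `∑ θ, exp (l * F θ s)`.
  have hpt : ∀ s, l * (⨆ θ, F θ s) ≤ Real.exp (-a) * ∑ θ, Real.exp (l * F θ s) + a - 1 := by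
    intro s
    obtain ⟨θ, hθ⟩ := exists_eq_ciSup_of_finite (f := fun θ => F θ s)
    have h1 : Real.exp (l * F θ s) ≤ ∑ θ, Real.exp (l * F θ s) :=
      Finset.single_le_sum (f := fun θ => Real.exp (l * F θ s)) (fun _ _ => (Real.exp_pos _).le)
        (Finset.mem_univ θ)
    have h2 := Real.add_one_le_exp (-a + l * F θ s)
    rw [Real.exp_add] at h2
    rw [← hθ]
    have := mul_le_mul_of_nonneg_left h1 (Real.exp_pos (-a)).le
    linarith
  have hsum : ∑ s, ∑ θ, Real.exp (l * F θ s) ≤ 2 ^ m * Real.exp a := by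
    rw [Finset.sum_comm]
    have : ∀ θ, ∑ s, Real.exp (l * F θ s) ≤ 2 ^ m * Real.exp (l * μ + l ^ 2 * m / 2) := by
      intro θ
      refine (sum_signs_exp_le (F θ) (hF θ) l).trans ?_
      gcongr
      exact hμ θ
    refine (Finset.sum_le_sum fun θ _ => this θ).trans ?_
    rw [Finset.sum_const, Finset.card_univ, nsmul_eq_mul, ha, Real.exp_add q]
    have := mul_le_mul_of_nonneg_right hq
      (show 0 ≤ 2 ^ m * Real.exp (l * μ + l ^ 2 * m / 2) by positivity)
    linarith
  have htot : l * ∑ s, ⨆ θ, F θ s ≤ 2 ^ m * a := by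
    rw [Finset.mul_sum]
    refine (Finset.sum_le_sum fun s _ => hpt s).trans ?_
    rw [Finset.sum_sub_distrib, Finset.sum_add_distrib, ← Finset.mul_sum, Finset.sum_const,
      Finset.sum_const, Finset.card_univ, nsmul_eq_mul, nsmul_eq_mul, card_signs]
    have h := mul_le_mul_of_nonneg_left hsum (Real.exp_pos (-a)).le
    have e : Real.exp (-a) * (2 ^ m * Real.exp a) = 2 ^ m := by
      rw [mul_left_comm, ← Real.exp_add]; simp
    linarith
  have e : μ + q / l + l * m / 2 = (2 ^ m)⁻¹ * ((2 ^ m * a) / l) := by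
    rw [ha]; field_simp; ring
  rw [e]
  refine mul_le_mul_of_nonneg_left ?_ (by positivity)
  rw [le_div_iff₀ hl]
  linarith

/-! ### Dyadic interpolation of Lipschitz functions -/

/-- The `1`-periodic triangle wave, zero at the integers and one at the half-integers. -/
noncomputable def triangleWave (u : ℝ) : ℝ := 1 - |2 * Int.fract u - 1|

theorem triangleWave_nonneg (u : ℝ) : 0 ≤ triangleWave u := by
  have h0 := Int.fract_nonneg u
  have h1 := Int.fract_lt_one u
  unfold triangleWave
  rw [sub_nonneg, abs_le]
  constructor <;> linarith

theorem triangleWave_le_one (u : ℝ) : triangleWave u ≤ 1 := by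
  unfold triangleWave
  linarith [abs_nonneg (2 * Int.fract u - 1)]

theorem triangleWave_le (u : ℝ) (n : ℤ) : triangleWave u ≤ 2 * |u - n| := by
  have h0 := Int.fract_nonneg u
  have h1 := Int.fract_lt_one u
  have hu := Int.floor_add_fract u
  unfold triangleWave
  rcases le_or_gt n ⌊u⌋ with h | h
  · have h' : (n : ℝ) ≤ ⌊u⌋ := by exact_mod_cast h
    have := le_abs_self (u - n)
    have := neg_le_abs (2 * Int.fract u - 1)
    linarith
  · have h' : (⌊u⌋ : ℝ) + 1 ≤ n := by exact_mod_cast h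
    have := neg_le_abs (u - n)
    have := le_abs_self (2 * Int.fract u - 1)
    linarith

/-- The triangle wave at frequency `2 ^ k`, weighted by `θ j` on the cell
`[j / 2 ^ k, (j + 1) / 2 ^ k)`. -/
noncomputable def weightedWave (k : ℕ) (θ : ℤ → ℝ) (t : ℝ) : ℝ :=
  θ ⌊2 ^ k * t⌋ * triangleWave (2 ^ k * t)

theorem abs_weightedWave_le_one (k : ℕ) {θ : ℤ → ℝ} (hθ : ∀ j, |θ j| ≤ 1) (t : ℝ) :
    |weightedWave k θ t| ≤ 1 := by
  unfold weightedWave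
  rw [abs_mul, abs_of_nonneg (triangleWave_nonneg _)]
  exact mul_le_one₀ (hθ _) (triangleWave_nonneg _) (triangleWave_le_one _)

theorem abs_weightedWave_sub_le (k : ℕ) {θ : ℤ → ℝ} (hθ : ∀ j, |θ j| ≤ 1) (t t' : ℝ) :
    |weightedWave k θ t - weightedWave k θ t'| ≤ |2 * 2 ^ k * t - 2 * 2 ^ k * t'| := by
  wlog h : t ≤ t' generalizing t t'
  · rw [abs_sub_comm, abs_sub_comm (2 * 2 ^ k * t)]
    exact this t' t (le_of_not_ge h)
  have e : |2 * 2 ^ k * t - 2 * 2 ^ k * t'| = 2 * (2 ^ k * t' - 2 ^ k * t) := by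
    rw [abs_sub_comm, abs_of_nonneg]
    · ring
    · have : (0 : ℝ) ≤ 2 * 2 ^ k * (t' - t) := mul_nonneg (by positivity) (by linarith)
      linarith
  rw [e]
  unfold weightedWave
  have hu : 2 ^ k * t ≤ 2 ^ k * t' := by gcongr
  set u := 2 ^ k * t
  set u' := 2 ^ k * t'
  by_cases hf : ⌊u⌋ = ⌊u'⌋
  · rw [hf, ← mul_sub, abs_mul]
    refine (mul_le_of_le_one_left (abs_nonneg _) (hθ _)).trans ?_
    unfold triangleWave
    have h1 := abs_abs_sub_abs_le (2 * Int.fract u' - 1) (2 * Int.fract u - 1)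
    have h2 : 2 * Int.fract u' - 1 - (2 * Int.fract u - 1) = 2 * (u' - u) := by
      rw [Int.fract, Int.fract, hf]; ring
    rw [h2, abs_of_nonneg (by linarith : 0 ≤ 2 * (u' - u))] at h1
    rwa [show (1 - |2 * Int.fract u - 1| - (1 - |2 * Int.fract u' - 1|))
      = |2 * Int.fract u' - 1| - |2 * Int.fract u - 1| by ring]
  -- The weight may jump between cells, but the wave vanishes at the integer `⌊u'⌋` between `u` and
  -- `u'`, so the two values are controlled by their distances to it.
  · have hlt : ⌊u⌋ < ⌊u'⌋ := lt_of_le_of_ne (Int.floor_mono hu) hf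
    have hlt' : u < ⌊u'⌋ := Int.floor_lt.1 hlt
    have hle := Int.floor_le u'
    have b1 := triangleWave_le u ⌊u'⌋
    have b2 := triangleWave_le u' ⌊u'⌋
    rw [abs_of_nonpos (by linarith)] at b1
    rw [abs_of_nonneg (by linarith)] at b2
    refine (abs_sub _ _).trans ?_
    rw [abs_mul, abs_mul, abs_of_nonneg (triangleWave_nonneg u),
      abs_of_nonneg (triangleWave_nonneg u')]
    have c1 := mul_le_of_le_one_left (triangleWave_nonneg u) (hθ ⌊u⌋)
    have c2 := mul_le_of_le_one_left (triangleWave_nonneg u') (hθ ⌊u'⌋)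
    linarith

/-- The piecewise linear interpolation of `h` at the points of `2 ^ (-k) ℤ`. -/
noncomputable def dyadicInterp (h : ℝ → ℝ) (k : ℕ) (t : ℝ) : ℝ :=
  h (⌊2 ^ k * t⌋ / 2 ^ k)
    + Int.fract (2 ^ k * t) * (h ((⌊2 ^ k * t⌋ + 1) / 2 ^ k) - h (⌊2 ^ k * t⌋ / 2 ^ k))

/-- The second difference of `h` on the dyadic interval `[j / 2 ^ k, (j + 1) / 2 ^ k]`. -/
noncomputable def dyadicCoeff (h : ℝ → ℝ) (k : ℕ) (j : ℤ) : ℝ :=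
  h ((2 * j + 1) / 2 ^ (k + 1)) - (h (j / 2 ^ k) + h ((j + 1) / 2 ^ k)) / 2

/-- Refining the grid only moves the midpoint value of each cell, by the second difference there;
the correction is linear on both halves. -/
theorem dyadicInterp_succ (h : ℝ → ℝ) (k : ℕ) (t : ℝ) :
    dyadicInterp h (k + 1) t = dyadicInterp h k t + weightedWave k (dyadicCoeff h k) t := by
  unfold dyadicInterp dyadicCoeff weightedWave triangleWave
  have e : (2 : ℝ) ^ (k + 1) * t = 2 * (2 ^ k * t) := by ring
  rw [e]
  set u := 2 ^ k * t
  have h0 := Int.fract_nonneg u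
  have h1 := Int.fract_lt_one u
  have hu := Int.floor_add_fract u
  have e1 : (2 * (⌊u⌋ : ℝ)) / 2 ^ (k + 1) = ⌊u⌋ / 2 ^ k := by
    rw [pow_succ, mul_comm ((2 : ℝ) ^ k)]; exact mul_div_mul_left _ _ two_ne_zero
  have e2 : (2 * (⌊u⌋ : ℝ) + 1 + 1) / 2 ^ (k + 1) = (⌊u⌋ + 1) / 2 ^ k := by
    rw [pow_succ, mul_comm ((2 : ℝ) ^ k), ← mul_div_mul_left ((⌊u⌋ : ℝ) + 1) _ two_ne_zero]
    ring
  rcases lt_or_ge (Int.fract u) (1 / 2) with hf | hf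
  · have hfl : ⌊2 * u⌋ = 2 * ⌊u⌋ := by
      rw [Int.floor_eq_iff]; push_cast; constructor <;> linarith
    have hfr : Int.fract (2 * u) = 2 * Int.fract u := by
      rw [Int.fract, Int.fract, hfl]; push_cast; ring
    rw [hfr, hfl, abs_of_nonpos (by linarith)]
    push_cast
    rw [e1]
    ring
  · have hfl : ⌊2 * u⌋ = 2 * ⌊u⌋ + 1 := by
      rw [Int.floor_eq_iff]; push_cast; constructor <;> linarith
    have hfr : Int.fract (2 * u) = 2 * Int.fract u - 1 := by
      rw [Int.fract, Int.fract, hfl]; push_cast; ring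
    rw [hfr, hfl, abs_of_nonneg (by linarith)]
    push_cast
    rw [e2]
    ring

theorem dyadicInterp_eq_sum (h : ℝ → ℝ) (k : ℕ) (t : ℝ) :
    dyadicInterp h k t
      = dyadicInterp h 0 t + ∑ j ∈ Finset.range k, weightedWave j (dyadicCoeff h j) t := by
  induction k with
  | zero => simp
  | succ k ih => rw [dyadicInterp_succ, ih, Finset.sum_range_succ, add_assoc]

theorem abs_dyadicCoeff_le {h : ℝ → ℝ} {L : ℝ} (hh : ∀ x y, |h x - h y| ≤ L * |x - y|)
    (k : ℕ) (j : ℤ) : |dyadicCoeff h k j| ≤ L * (2 ^ (k + 1))⁻¹ := by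
  unfold dyadicCoeff
  have a1 := hh ((2 * j + 1) / 2 ^ (k + 1)) (j / 2 ^ k)
  have a2 := hh ((2 * j + 1) / 2 ^ (k + 1)) ((j + 1) / 2 ^ k)
  have e1 : (2 * (j : ℝ) + 1) / 2 ^ (k + 1) - j / 2 ^ k = (2 ^ (k + 1))⁻¹ := by
    rw [pow_succ]; field_simp; ring
  have e2 : (2 * (j : ℝ) + 1) / 2 ^ (k + 1) - (j + 1) / 2 ^ k = -(2 ^ (k + 1))⁻¹ := by
    rw [pow_succ]; field_simp; ring
  have hpos : (0 : ℝ) ≤ (2 ^ (k + 1))⁻¹ := by positivity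
  rw [e1, abs_of_nonneg hpos] at a1
  rw [e2, abs_neg, abs_of_nonneg hpos] at a2
  rw [abs_le] at a1 a2 ⊢
  constructor <;> linarith [a1.1, a1.2, a2.1, a2.2]

/-- The error is a convex combination of the increments of `h` from `t` to the two ends of its cell.
-/
theorem abs_sub_dyadicInterp_le {h : ℝ → ℝ} {L : ℝ} (hL : 0 ≤ L)
    (hh : ∀ x y, |h x - h y| ≤ L * |x - y|) (k : ℕ) (t : ℝ) :
    |h t - dyadicInterp h k t| ≤ L * (2 ^ k)⁻¹ := by
  unfold dyadicInterp
  have hp : (0 : ℝ) < 2 ^ k := by positivity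
  have ht : t = (2 ^ k * t) / 2 ^ k := by field_simp
  have a1 := hh t (⌊2 ^ k * t⌋ / 2 ^ k)
  have a2 := hh t ((⌊2 ^ k * t⌋ + 1) / 2 ^ k)
  set u := 2 ^ k * t
  have h0 := Int.fract_nonneg u
  have h1 := Int.fract_lt_one u
  have hu := Int.floor_add_fract u
  have b1 : |t - ⌊u⌋ / 2 ^ k| ≤ (2 ^ k)⁻¹ := by
    have : t - ⌊u⌋ / 2 ^ k = Int.fract u * (2 ^ k)⁻¹ := by
      rw [ht, ← sub_div, div_eq_mul_inv, Int.fract]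
    rw [this, abs_of_nonneg (by positivity)]
    exact mul_le_of_le_one_left (by positivity) h1.le
  have b2 : |t - (⌊u⌋ + 1) / 2 ^ k| ≤ (2 ^ k)⁻¹ := by
    have : t - (⌊u⌋ + 1) / 2 ^ k = -((1 - Int.fract u) * (2 ^ k)⁻¹) := by
      rw [ht, ← sub_div, div_eq_mul_inv, Int.fract]; ring
    rw [this, abs_neg, abs_of_nonneg (mul_nonneg (by linarith) (by positivity))]
    exact mul_le_of_le_one_left (by positivity) (by linarith)
  have a1' := a1.trans (mul_le_mul_of_nonneg_left b1 hL)
  have a2' := a2.trans (mul_le_mul_of_nonneg_left b2 hL)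
  have e : h t - (h (⌊u⌋ / 2 ^ k) + Int.fract u * (h ((⌊u⌋ + 1) / 2 ^ k) - h (⌊u⌋ / 2 ^ k)))
      = (1 - Int.fract u) * (h t - h (⌊u⌋ / 2 ^ k))
        + Int.fract u * (h t - h ((⌊u⌋ + 1) / 2 ^ k)) := by ring
  rw [e]
  refine (abs_add_le _ _).trans ?_
  rw [abs_mul, abs_mul, abs_of_nonneg h0, abs_of_nonneg (by linarith : 0 ≤ 1 - Int.fract u)]
  have c1 := mul_le_mul_of_nonneg_left a1' (by linarith : 0 ≤ 1 - Int.fract u)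
  have c2 := mul_le_mul_of_nonneg_left a2' h0
  linarith

/-- On `[-1/2, 1/2]` the coarsest interpolation is itself a weighted triangle wave. -/
theorem dyadicInterp_zero_eq {h : ℝ → ℝ} (h0 : h 0 = 0) {t : ℝ} (ht : |t| ≤ 1 / 2) :
    dyadicInterp h 0 t = weightedWave 0 (fun j => (if j = 0 then h 1 else h (-1)) / 2) t := by
  unfold dyadicInterp weightedWave triangleWave
  rw [abs_le] at ht
  simp only [pow_zero, one_mul, div_one]
  -- Here the wave equals `2 * |t|`, whence the halved weights `h (±1) / 2`.
  rcases lt_or_ge t 0 with hneg | hnn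
  · have hfl : ⌊t⌋ = -1 := by
      rw [Int.floor_eq_iff]; push_cast; constructor <;> linarith
    have hfr : Int.fract t = t + 1 := by rw [Int.fract, hfl]; push_cast; ring
    rw [hfr, hfl, abs_of_nonneg (by linarith)]
    simp [h0]
    ring
  · have hfl : ⌊t⌋ = 0 := by
      rw [Int.floor_eq_iff]; push_cast; constructor <;> linarith
    have hfr : Int.fract t = t := by rw [Int.fract, hfl]; push_cast; ring
    rw [hfr, hfl, abs_of_nonpos (by linarith)]
    simp [h0]
    ring

/-! ### Suprema over weighted triangle waves -/

/-- A choice of sign on each dyadic cell of length `2 ^ (-k)` in `[-1, 1)`. -/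
abbrev DyadicSigns (k : ℕ) : Type := Finset.Ico (-2 ^ k : ℤ) (2 ^ k) → ℤˣ

/-- The weights given by a choice of signs, extended by one outside `[-1, 1)`. -/
noncomputable def DyadicSigns.weight {k : ℕ} (θ : DyadicSigns k) (j : ℤ) : ℝ :=
  if hj : j ∈ Finset.Ico (-2 ^ k : ℤ) (2 ^ k) then ((θ ⟨j, hj⟩ : ℤ) : ℝ) else 1

theorem DyadicSigns.abs_weight {k : ℕ} (θ : DyadicSigns k) (j : ℤ) : |θ.weight j| ≤ 1 := by
  unfold DyadicSigns.weight
  split_ifs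
  · exact (abs_sign _).le
  · simp

theorem DyadicSigns.card_le (k : ℕ) :
    (Fintype.card (DyadicSigns k) : ℝ) ≤ Real.exp (2 * 2 ^ k) := by
  have h1 : Fintype.card (DyadicSigns k) = 2 ^ (2 * 2 ^ k) := by
    rw [Fintype.card_fun, Fintype.card_units_int, Fintype.card_coe, Int.card_Ico]
    congr 1
    have : (2 ^ k - -2 ^ k : ℤ) = ((2 * 2 ^ k : ℕ) : ℤ) := by push_cast; ring
    rw [this, Int.toNat_natCast]
  have h2 : (2 : ℝ) ≤ Real.exp 1 := by linarith [Real.add_one_le_exp (1 : ℝ)]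
  rw [h1]
  calc (((2 ^ (2 * 2 ^ k) : ℕ)) : ℝ) = 2 ^ (2 * 2 ^ k) := by push_cast; rfl
    _ ≤ Real.exp 1 ^ (2 * 2 ^ k) := pow_le_pow_left₀ zero_le_two h2 _
    _ = Real.exp (2 * 2 ^ k) := by rw [← Real.exp_nat_mul]; push_cast; simp

section InnerProductSpace

variable {E : Type*} [NormedAddCommGroup E] [InnerProductSpace ℝ E]

/-- The supremum of a signed sum of one weighted wave over all directions in the unit ball. -/
noncomputable def waveSup {m : ℕ} (y : Fin m → E) (k : ℕ) (θ : DyadicSigns k)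
    (s : Fin m → ℤˣ) : ℝ :=
  ⨆ v : Metric.closedBall (0 : E) 1,
    ∑ i, ((s i : ℤ) : ℝ) * weightedWave k θ.weight (inner ℝ (v : E) (y i))

/-- The largest of the suprema `waveSup` over all choices of signs on the dyadic cells. -/
noncomputable def waveMax {m : ℕ} (y : Fin m → E) (k : ℕ) (s : Fin m → ℤˣ) : ℝ :=
  ⨆ θ : DyadicSigns k, waveSup y k θ s

theorem bddAbove_wave {m : ℕ} (y : Fin m → E) (k : ℕ) (θ : DyadicSigns k) (s : Fin m → ℤˣ) :
    BddAbove (Set.range fun v : Metric.closedBall (0 : E) 1 =>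
      ∑ i, ((s i : ℤ) : ℝ) * weightedWave k θ.weight (inner ℝ (v : E) (y i))) :=
  bddAbove_range_of_abs_le (exists_abs_signed_sum_le
    (f := fun i (v : Metric.closedBall (0 : E) 1) =>
      weightedWave k θ.weight (inner ℝ (v : E) (y i)))
    (fun _ => ⟨1, fun _ => abs_weightedWave_le_one k θ.abs_weight _⟩) s)

instance nonempty_unitBall : Nonempty (Metric.closedBall (0 : E) 1) :=
  ⟨⟨0, by simp⟩⟩

theorem le_waveMax {m : ℕ} (y : Fin m → E) (k : ℕ) (θ : DyadicSigns k) (s : Fin m → ℤˣ) {v : E}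
    (hv : ‖v‖ ≤ 1) :
    ∑ i, ((s i : ℤ) : ℝ) * weightedWave k θ.weight (inner ℝ v (y i)) ≤ waveMax y k s :=
  (le_ciSup (bddAbove_wave y k θ s) ⟨v, by simpa using hv⟩).trans
    (le_ciSup (f := fun θ => waveSup y k θ s) (Set.finite_range _).bddAbove θ)

theorem waveSup_sub_le {m : ℕ} (y : Fin m → E) (k : ℕ) (θ : DyadicSigns k) {s s' : Fin m → ℤˣ}
    {i : Fin m} (h : ∀ j, j ≠ i → s j = s' j) : waveSup y k θ s - waveSup y k θ s' ≤ 2 := by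
  rw [sub_le_iff_le_add]
  refine ciSup_le fun v => ?_
  have h1 := le_ciSup (bddAbove_wave y k θ s') v
  have h2 : ∑ j, ((s j : ℤ) : ℝ) * weightedWave k θ.weight (inner ℝ (v : E) (y j))
      - ∑ j, ((s' j : ℤ) : ℝ) * weightedWave k θ.weight (inner ℝ (v : E) (y j)) ≤ 2 := by
    rw [← Finset.sum_sub_distrib, Finset.sum_eq_single i]
    · refine (le_abs_self _).trans ((abs_sub _ _).trans ?_)
      rw [abs_mul, abs_mul, abs_sign, abs_sign]
      linarith [abs_weightedWave_le_one k θ.abs_weight (inner ℝ (v : E) (y i))]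
    · intro j _ hj
      rw [h j hj, sub_self]
    · simp
  have : waveSup y k θ s' = ⨆ v : Metric.closedBall (0 : E) 1,
    ∑ i, ((s' i : ℤ) : ℝ) * weightedWave k θ.weight (inner ℝ (v : E) (y i)) := rfl
  rw [this]
  linarith

/-- Contraction replaces the wave by the linear map `2 * 2 ^ k * ⟨v, y i⟩`, whose signed supremum is
a norm. The factor `2` cancels against `‖y i‖ ≤ 1 / 2`. -/
theorem average_waveSup_le {m : ℕ} {y : Fin m → E} (hy : ∀ i, ‖y i‖ ≤ 1 / 2) (k : ℕ)
    (θ : DyadicSigns k) : (2 ^ m)⁻¹ * ∑ s, waveSup y k θ s ≤ 2 ^ k * √m := by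
  have hin : ∀ (v : Metric.closedBall (0 : E) 1) (z : E), |inner ℝ (v : E) z| ≤ ‖z‖ := by
    intro v z
    have hv : ‖(v : E)‖ ≤ 1 := mem_closedBall_zero_iff.1 v.2
    exact (abs_real_inner_le_norm _ _).trans (mul_le_of_le_one_left (norm_nonneg _) hv)
  have h1 := sum_signs_iSup_le_of_contraction (T := Metric.closedBall (0 : E) 1)
    (fun _ => 0) (fun i v => 2 * 2 ^ k * inner ℝ (v : E) (y i))
    (fun i v => weightedWave k θ.weight (inner ℝ (v : E) (y i))) ⟨0, by simp⟩
    (fun i => ⟨2 * 2 ^ k * ‖y i‖, fun v => by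
      rw [abs_mul, abs_of_nonneg (by positivity : (0 : ℝ) ≤ 2 * 2 ^ k)]
      exact mul_le_mul_of_nonneg_left (hin v _) (by positivity)⟩)
    (fun i => ⟨1, fun v => abs_weightedWave_le_one k θ.abs_weight _⟩)
    (fun i v v' => abs_weightedWave_sub_le k θ.abs_weight _ _)
  simp only [zero_add] at h1
  have h2 : ∑ s : Fin m → ℤˣ, ⨆ v : Metric.closedBall (0 : E) 1,
      ∑ i, ((s i : ℤ) : ℝ) * (2 * 2 ^ k * inner ℝ (v : E) (y i))
        ≤ ∑ s : Fin m → ℤˣ, 2 * 2 ^ k * ‖∑ i, ((s i : ℤ) : ℝ) • y i‖ := by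
    refine Finset.sum_le_sum fun s _ => ciSup_le fun v => ?_
    have e : ∑ i, ((s i : ℤ) : ℝ) * (2 * 2 ^ k * inner ℝ (v : E) (y i))
        = 2 * 2 ^ k * inner ℝ (v : E) (∑ i, ((s i : ℤ) : ℝ) • y i) := by
      rw [inner_sum, Finset.mul_sum]
      refine Finset.sum_congr rfl fun i _ => ?_
      rw [real_inner_smul_right]; ring
    rw [e]
    exact mul_le_mul_of_nonneg_left ((le_abs_self _).trans (hin v _)) (by positivity)
  have h3 := sum_signs_norm_le y (by norm_num) hy
  rw [← Finset.mul_sum] at h2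
  have h4 : ∑ s, waveSup y k θ s ≤ 2 ^ m * (2 ^ k * √m) := by
    refine (h1.trans h2).trans ?_
    have := mul_le_mul_of_nonneg_left h3 (by positivity : (0 : ℝ) ≤ 2 * 2 ^ k)
    linarith
  rw [inv_mul_le_iff₀ (by positivity)]
  exact h4

theorem average_waveMax_le {m : ℕ} (hm : 0 < m) {y : Fin m → E} (hy : ∀ i, ‖y i‖ ≤ 1 / 2)
    (k : ℕ) : (2 ^ m)⁻¹ * ∑ s, waveMax y k s ≤ 3 * 2 ^ k * √m := by
  have hm' : (0 : ℝ) < m := by exact_mod_cast hm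
  have hs : 0 < √(m : ℝ) := Real.sqrt_pos.2 hm'
  have h := sum_signs_iSup_le_of_bounded_differences (fun θ s => waveSup y k θ s)
    (fun θ s s' i hss => by
      rw [abs_le]
      have h1 := waveSup_sub_le y k θ hss
      have h2 := waveSup_sub_le y k θ (fun j hj => (hss j hj).symm)
      constructor <;> linarith)
    -- This `l` makes the entropy term `√m` and the variance term `2 ^ k * √m`.
    (by positivity : 0 < 2 * 2 ^ k / √(m : ℝ)) (average_waveSup_le hy k) (DyadicSigns.card_le k)
  refine h.trans ?_
  have e1 : 2 * 2 ^ k / (2 * 2 ^ k / √(m : ℝ)) = √m := by field_simp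
  have e2 : 2 * 2 ^ k / √(m : ℝ) * m / 2 = 2 ^ k * √m := by
    nth_rewrite 2 [← Real.mul_self_sqrt hm'.le]
    field_simp
  rw [e1, e2]
  have : (1 : ℝ) ≤ 2 ^ k := one_le_pow₀ one_le_two
  nlinarith

theorem floor_mem_Ico {t : ℝ} (ht : |t| ≤ 1 / 2) (k : ℕ) :
    ⌊2 ^ k * t⌋ ∈ Finset.Ico (-2 ^ k : ℤ) (2 ^ k) := by
  have hp : (0 : ℝ) < 2 ^ k := by positivity
  rw [abs_le] at ht
  rw [Finset.mem_Ico, Int.le_floor, Int.floor_lt]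
  push_cast
  constructor <;> nlinarith

/-- A signed sum of a weighted wave is largest for a wave whose weights are signs. -/
theorem sum_weightedWave_le {m : ℕ} {y : Fin m → E} (hy : ∀ i, ‖y i‖ ≤ 1 / 2) (k : ℕ)
    {a : ℤ → ℝ} {A : ℝ} (ha : ∀ j, |a j| ≤ A) (s : Fin m → ℤˣ) {v : E} (hv : ‖v‖ ≤ 1) :
    ∑ i, ((s i : ℤ) : ℝ) * weightedWave k a (inner ℝ v (y i)) ≤ A * waveMax y k s := by
  classical
  have hA : 0 ≤ A := (abs_nonneg _).trans (ha 0)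
  have ht : ∀ i, |inner ℝ v (y i)| ≤ 1 / 2 := fun i =>
    ((abs_real_inner_le_norm _ _).trans (mul_le_of_le_one_left (norm_nonneg _) hv)).trans (hy i)
  set t : Fin m → ℝ := fun i => inner ℝ v (y i) with htd
  set S : ℤ → ℝ := fun j => ∑ i with ⌊2 ^ k * t i⌋ = j,
    ((s i : ℤ) : ℝ) * triangleWave (2 ^ k * t i) with hS
  have hsplit : ∀ w : ℤ → ℝ, ∑ i, ((s i : ℤ) : ℝ) * weightedWave k w (t i)
      = ∑ j ∈ Finset.Ico (-2 ^ k : ℤ) (2 ^ k), w j * S j := by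
    intro w
    rw [← Finset.sum_fiberwise_of_maps_to (g := fun i => ⌊2 ^ k * t i⌋)
      (fun i _ => floor_mem_Ico (ht i) k)]
    refine Finset.sum_congr rfl fun j _ => ?_
    rw [hS, Finset.mul_sum]
    refine Finset.sum_congr rfl fun i hi => ?_
    rw [weightedWave, (Finset.mem_filter.1 hi).2]
    ring
  -- `S j` collects the contribution of cell `j`; matching its sign turns it into `|S j|`.
  set θ : DyadicSigns k := fun j => if 0 ≤ S j then 1 else -1 with hθ
  refine le_trans ?_ (mul_le_mul_of_nonneg_left (le_waveMax y k θ s hv) hA)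
  change ∑ i, ((s i : ℤ) : ℝ) * weightedWave k a (t i)
    ≤ A * ∑ i, ((s i : ℤ) : ℝ) * weightedWave k θ.weight (t i)
  rw [hsplit, hsplit, Finset.mul_sum]
  refine Finset.sum_le_sum fun j hj => ?_
  have hw : θ.weight j * S j = |S j| := by
    rw [DyadicSigns.weight, dif_pos hj, hθ]
    dsimp only
    split_ifs with h
    · simp [abs_of_nonneg h]
    · simp [abs_of_neg (not_le.1 h)]
  rw [hw]
  refine (le_abs_self _).trans ?_
  rw [abs_mul]
  exact mul_le_mul_of_nonneg_right (ha j) (abs_nonneg _)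

/-- A bound on signed sums of Lipschitz ridge functions vanishing at zero. -/
noncomputable def ridgeBound {m : ℕ} (y : Fin m → E) (s : Fin m → ℤˣ) : ℝ :=
  1 / 2 * waveMax y 0 s
    + ∑ k ∈ Finset.range (Nat.log 2 m + 1), (2 ^ (k + 1))⁻¹ * waveMax y k s + 1

theorem sum_lipschitz_ridge_le {m : ℕ} {y : Fin m → E} (hy : ∀ i, ‖y i‖ ≤ 1 / 2)
    {h : ℝ → ℝ} {L : ℝ} (hL : 0 ≤ L) (hh : ∀ x y, |h x - h y| ≤ L * |x - y|) (h0 : h 0 = 0)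
    (s : Fin m → ℤˣ) {v : E} (hv : ‖v‖ ≤ 1) :
    ∑ i, ((s i : ℤ) : ℝ) * h (inner ℝ v (y i)) ≤ L * ridgeBound y s := by
  have ht : ∀ i, |inner ℝ v (y i)| ≤ 1 / 2 := fun i =>
    ((abs_real_inner_le_norm _ _).trans (mul_le_of_le_one_left (norm_nonneg _) hv)).trans (hy i)
  -- With `m ≤ 2 ^ K`, the `m` truncation errors `L / 2 ^ K` add up to at most `L`: the `+ 1` in
  -- `ridgeBound`.
  set K := Nat.log 2 m + 1 with hK
  set a : ℤ → ℝ := fun j => (if j = 0 then h 1 else h (-1)) / 2 with ha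
  have hab : ∀ j, |a j| ≤ L * (1 / 2) := by
    intro j
    have h1 := hh 1 0
    have h2 := hh (-1) 0
    simp only [h0, sub_zero, abs_neg, abs_one, mul_one] at h1 h2
    rw [ha]
    dsimp only
    rw [abs_div, abs_two]
    split_ifs <;> linarith
  have hdec : ∀ i, ((s i : ℤ) : ℝ) * h (inner ℝ v (y i))
      ≤ ((s i : ℤ) : ℝ) * weightedWave 0 a (inner ℝ v (y i))
        + ∑ k ∈ Finset.range K,
          ((s i : ℤ) : ℝ) * weightedWave k (dyadicCoeff h k) (inner ℝ v (y i))
        + L * (2 ^ K)⁻¹ := by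
    intro i
    have h1 := abs_sub_dyadicInterp_le hL hh K (inner ℝ v (y i))
    rw [← one_mul |_|, ← abs_sign (s i), ← abs_mul] at h1
    have h2 := (le_abs_self _).trans h1
    rw [dyadicInterp_eq_sum, dyadicInterp_zero_eq h0 (ht i)] at h2
    rw [← Finset.mul_sum]
    linarith
  refine (Finset.sum_le_sum fun i _ => hdec i).trans ?_
  rw [Finset.sum_add_distrib, Finset.sum_add_distrib, Finset.sum_comm, Finset.sum_const,
    Finset.card_univ, Fintype.card_fin, nsmul_eq_mul, ridgeBound, mul_add, mul_add]
  refine add_le_add (add_le_add ?_ ?_) ?_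
  · rw [← mul_assoc]
    exact sum_weightedWave_le hy 0 hab s hv
  · rw [Finset.mul_sum]
    refine Finset.sum_le_sum fun k _ => ?_
    rw [← mul_assoc]
    exact sum_weightedWave_le hy k (abs_dyadicCoeff_le hh k) s hv
  · have h1 : (m : ℝ) ≤ 2 ^ K := by
      exact_mod_cast (Nat.lt_pow_succ_log_self (by norm_num) m).le
    have h2 : (m : ℝ) * (2 ^ K)⁻¹ ≤ 1 := by
      rw [mul_inv_le_iff₀ (by positivity)]; linarith
    have := mul_le_mul_of_nonneg_left h2 hL
    linarith

theorem average_ridgeBound_le {m : ℕ} (hm : 0 < m) {y : Fin m → E} (hy : ∀ i, ‖y i‖ ≤ 1 / 2) :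
    (2 ^ m)⁻¹ * ∑ s, ridgeBound y s ≤ 4 * (1 + Real.log m) * √m := by
  have hm1 : (1 : ℝ) ≤ m := by exact_mod_cast hm
  have hs1 : 1 ≤ √(m : ℝ) := Real.one_le_sqrt.2 hm1
  have e : (2 ^ m)⁻¹ * ∑ s, ridgeBound y s
      = 1 / 2 * ((2 ^ m)⁻¹ * ∑ s, waveMax y 0 s)
        + ∑ k ∈ Finset.range (Nat.log 2 m + 1),
          (2 ^ (k + 1))⁻¹ * ((2 ^ m)⁻¹ * ∑ s, waveMax y k s) + 1 := by
    simp only [ridgeBound, Finset.sum_add_distrib]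
    rw [Finset.sum_comm, ← Finset.mul_sum, Finset.sum_const, Finset.card_univ, nsmul_eq_mul,
      card_signs, mul_add, mul_add]
    congr 1
    · congr 1
      · ring
      · rw [Finset.mul_sum]
        refine Finset.sum_congr rfl fun k _ => ?_
        rw [← Finset.mul_sum]; ring
    · field_simp
  have h0 := average_waveMax_le hm hy 0
  have hk : ∀ k ∈ Finset.range (Nat.log 2 m + 1),
      (2 ^ (k + 1))⁻¹ * ((2 ^ m)⁻¹ * ∑ s, waveMax y k s) ≤ 3 / 2 * √m := by
    intro k _
    refine (mul_le_mul_of_nonneg_left (average_waveMax_le hm hy k) (by positivity)).trans_eq ?_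
    rw [pow_succ]; field_simp
  have hsum := Finset.sum_le_sum hk
  rw [Finset.sum_const, Finset.card_range, nsmul_eq_mul] at hsum
  have hlog : (Nat.log 2 m : ℝ) ≤ 3 / 2 * Real.log m := by
    have h1 : ((2 ^ Nat.log 2 m : ℕ) : ℝ) ≤ m := by exact_mod_cast Nat.pow_log_le_self 2 hm.ne'
    have h2 := Real.log_le_log (by positivity) h1
    push_cast at h2
    rw [Real.log_pow] at h2
    have h3 := Real.log_two_gt_d9
    have h4 : (0 : ℝ) ≤ Nat.log 2 m := by positivity
    nlinarith
  have hl0 := Real.log_nonneg hm1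
  rw [e]
  push_cast at hsum
  simp only [pow_zero, mul_one] at h0
  have h5 : (Nat.log 2 m + 1 : ℝ) * (3 / 2 * √m) ≤ (3 / 2 * Real.log m + 1) * (3 / 2 * √m) := by
    gcongr
  nlinarith [mul_nonneg hl0 (Real.sqrt_nonneg (m : ℝ))]

end InnerProductSpace

/-! ### One-hidden-layer networks -/

theorem abs_sum_activation_le {E : Type*} [NormedAddCommGroup E] [InnerProductSpace ℝ E] {m : ℕ}
    {σ : ℝ → ℝ} {L : ℝ≥0} (hσ : LipschitzWith L σ) (h0 : σ 0 = 0) {r : ℝ} (hr : 0 < r)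
    {x : Fin m → E} (hx : ∀ i, ‖x i‖ ≤ r) (s : Fin m → ℤˣ) (w : E) :
    |∑ i, ((s i : ℤ) : ℝ) * σ (inner ℝ w (x i))|
      ≤ 2 * L * r * ‖w‖ * ridgeBound (fun i => (2 * r)⁻¹ • x i) s := by
  have hy : ∀ i, ‖(2 * r)⁻¹ • x i‖ ≤ 1 / 2 := by
    intro i
    rw [norm_smul, Real.norm_of_nonneg (by positivity), inv_mul_le_iff₀ (by positivity)]
    linarith [hx i]
  -- For `w = 0` the convention `0⁻¹ = 0` gives the zero vector.
  have hv : ‖‖w‖⁻¹ • w‖ ≤ 1 := by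
    rw [norm_smul, norm_inv, norm_norm]
    exact inv_mul_le_one
  have hin : ∀ i, 2 * r * ‖w‖ * inner ℝ (‖w‖⁻¹ • w) ((2 * r)⁻¹ • x i) = inner ℝ w (x i) := by
    intro i
    rw [real_inner_smul_left, real_inner_smul_right]
    rcases eq_or_ne w 0 with rfl | hw
    · simp
    · have : ‖w‖ ≠ 0 := norm_ne_zero_iff.2 hw
      field_simp
  have hlip : ∀ a b : ℝ, |σ (2 * r * ‖w‖ * a) - σ (2 * r * ‖w‖ * b)|
      ≤ 2 * L * r * ‖w‖ * |a - b| := by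
    intro a b
    have h := hσ.dist_le_mul (2 * r * ‖w‖ * a) (2 * r * ‖w‖ * b)
    rw [Real.dist_eq, Real.dist_eq, ← mul_sub, abs_mul,
      abs_of_nonneg (by positivity : 0 ≤ 2 * r * ‖w‖)] at h
    linarith
  -- The absolute value comes from applying the bound to both `h` and `-h`.
  have hp := sum_lipschitz_ridge_le hy (h := fun t => σ (2 * r * ‖w‖ * t)) (by positivity) hlip
    (by simp [h0]) s hv
  have hn := sum_lipschitz_ridge_le hy (h := fun t => -σ (2 * r * ‖w‖ * t))
    (L := 2 * L * r * ‖w‖) (by positivity)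
    (fun a b => by rw [neg_sub_neg, abs_sub_comm]; exact hlip a b) (by simp [h0]) s hv
  simp only [hin, mul_neg, Finset.sum_neg_distrib] at hp hn
  exact abs_le'.2 ⟨hp, hn⟩

theorem ridgeBound_nonneg {E : Type*} [NormedAddCommGroup E] [InnerProductSpace ℝ E] {m : ℕ}
    {y : Fin m → E} (hy : ∀ i, ‖y i‖ ≤ 1 / 2) (s : Fin m → ℤˣ) : 0 ≤ ridgeBound y s := by
  have h := sum_lipschitz_ridge_le hy (h := fun _ => 0) (L := 1) zero_le_one
    (fun a b => by simp) rfl s (v := 0) (by simp)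
  simpa using h

section Frobenius

open scoped Matrix.Norms.Frobenius

theorem sum_abs_mul_norm_row_le {n d : ℕ} (u : EuclideanSpace ℝ (Fin n))
    (W : Matrix (Fin n) (Fin d) ℝ) :
    ∑ j, |u j| * ‖WithLp.toLp 2 (W j)‖ ≤ ‖u‖ * ‖W‖ := by
  have h := Real.sum_mul_le_sqrt_mul_sqrt Finset.univ (fun j => |u j|)
    (fun j => ‖WithLp.toLp 2 (W j)‖)
  refine h.trans_eq ?_
  congr 1
  · rw [EuclideanSpace.norm_eq]; simp
  · rw [Matrix.frobenius_norm_def, ← Real.sqrt_eq_rpow]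
    congr 1
    refine Finset.sum_congr rfl fun j _ => ?_
    rw [EuclideanSpace.norm_sq_eq]
    simp

theorem rademacherComplexity_frobeniusClass_le {σ : ℝ → ℝ} {L : ℝ≥0} (hσ : LipschitzWith L σ)
    (h0 : σ 0 = 0) {b B r : ℝ} (hb : 0 < b) (hB : 0 < B) (hr : 0 < r) (n d : ℕ) {m : ℕ}
    (hm : 0 < m) :
    rademacherComplexity m {x : EuclideanSpace ℝ (Fin d) | ‖x‖ ≤ r} (frobeniusClass σ b B n d)
      ≤ ((8 * (b * B * r * L) * (1 + Real.log m) / √m : ℝ) : EReal) := by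
  have hm' : (0 : ℝ) < m := by exact_mod_cast hm
  refine iSup_le fun x => ?_
  have hx : ∀ i, ‖(x i : EuclideanSpace ℝ (Fin d))‖ ≤ r := fun i => (x i).2
  set y : Fin m → EuclideanSpace ℝ (Fin d) := fun i => (2 * r)⁻¹ • (x i : _) with hyd
  have hy : ∀ i, ‖y i‖ ≤ 1 / 2 := by
    intro i
    rw [hyd, norm_smul, Real.norm_of_nonneg (by positivity), inv_mul_le_iff₀ (by positivity)]
    linarith [hx i]
  have hpt : ∀ s : Fin m → ℤˣ, ⨆ f ∈ frobeniusClass σ b B n d,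
      (((1 / (m : ℝ)) * ∑ i, ((s i : ℤ) : ℝ) * f (x i) : ℝ) : EReal)
        ≤ (((1 / (m : ℝ)) * (2 * L * r * (b * B) * ridgeBound y s) : ℝ) : EReal) := by
    intro s
    refine iSup₂_le fun f hf => ?_
    obtain ⟨u, W, hu, hW, rfl⟩ := hf
    rw [EReal.coe_le_coe_iff]
    refine mul_le_mul_of_nonneg_left ?_ (by positivity)
    have hR := ridgeBound_nonneg hy s
    have e : ∑ i, ((s i : ℤ) : ℝ) * oneHiddenLayer σ u W (x i)
        = ∑ j, u j * ∑ i, ((s i : ℤ) : ℝ) * σ (inner ℝ (WithLp.toLp 2 (W j))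
          (x i : EuclideanSpace ℝ (Fin d))) := by
      simp only [oneHiddenLayer, Finset.mul_sum]
      rw [Finset.sum_comm]
      refine Finset.sum_congr rfl fun j _ => Finset.sum_congr rfl fun i _ => ?_
      have : W.mulVec (x i : EuclideanSpace ℝ (Fin d)).ofLp j
          = inner ℝ (WithLp.toLp 2 (W j)) (x i : EuclideanSpace ℝ (Fin d)) := by
        simp [Matrix.mulVec, dotProduct, PiLp.inner_apply, mul_comm]
      rw [this]; ring
    rw [e]
    calc _ ≤ ∑ j, 2 * L * r * ridgeBound y s * (|u j| * ‖WithLp.toLp 2 (W j)‖) := by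
          refine Finset.sum_le_sum fun j _ => (le_abs_self _).trans ?_
          rw [abs_mul]
          have := mul_le_mul_of_nonneg_left
            (abs_sum_activation_le hσ h0 hr hx s (WithLp.toLp 2 (W j))) (abs_nonneg (u j))
          refine this.trans_eq ?_
          ring
      _ ≤ 2 * L * r * ridgeBound y s * (b * B) := by
          rw [← Finset.mul_sum]
          refine mul_le_mul_of_nonneg_left ?_ (by positivity)
          exact (sum_abs_mul_norm_row_le u W).trans
            (mul_le_mul hu hW (norm_nonneg _) hb.le)
      _ = _ := by ring
  have hsum : (∑ s : Fin m → ℤˣ, ⨆ f ∈ frobeniusClass σ b B n d,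
      (((1 / (m : ℝ)) * ∑ i, ((s i : ℤ) : ℝ) * f (x i) : ℝ) : EReal))
      ≤ ((∑ s : Fin m → ℤˣ, (1 / (m : ℝ)) * (2 * L * r * (b * B) * ridgeBound y s) : ℝ)
        : EReal) := by
    rw [show ((∑ s : Fin m → ℤˣ, (1 / (m : ℝ)) * (2 * L * r * (b * B) * ridgeBound y s) : ℝ)
        : EReal) = ∑ s : Fin m → ℤˣ,
          (((1 / (m : ℝ)) * (2 * L * r * (b * B) * ridgeBound y s) : ℝ) : EReal) from
      map_sum (⟨⟨Real.toEReal, EReal.coe_zero⟩, EReal.coe_add⟩ : ℝ →+ EReal) _ _]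
    exact Finset.sum_le_sum fun s _ => hpt s
  refine (mul_le_mul_of_nonneg_left hsum
    (by exact_mod_cast (by positivity : (0 : ℝ) ≤ (2 ^ m)⁻¹))).trans ?_
  rw [← EReal.coe_mul, EReal.coe_le_coe_iff, ← Finset.mul_sum, ← Finset.mul_sum]
  have hav := mul_le_mul_of_nonneg_left (average_ridgeBound_le hm hy)
    (by positivity : 0 ≤ 1 / (m : ℝ) * (2 * L * r * (b * B)))
  have hsq : √(m : ℝ) / m = 1 / √m := Real.sqrt_div_self'
  calc _ = 1 / (m : ℝ) * (2 * L * r * (b * B)) * ((2 ^ m)⁻¹ * ∑ s, ridgeBound y s) := by ring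
    _ ≤ _ := hav
    _ = 8 * (b * B * r * L) * (1 + Real.log m) * (√m / m) := by ring
    _ = _ := by rw [hsq]; ring

end Frobenius

/-! ### Sample sizes -/

theorem mul_div_sqrt_le {a ε : ℝ} (hε : 0 < ε) {m : ℕ} (hm : 0 < m)
    (h : 256 * (a ^ 2 * (1 + Real.log m ^ 3) / ε ^ 2) ≤ (m : ℝ)) :
    8 * a * (1 + Real.log m) / √m ≤ ε := by
  have hm' : (0 : ℝ) < m := by exact_mod_cast hm
  have hl : 0 ≤ Real.log m := Real.log_nonneg (by exact_mod_cast hm)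
  -- The square of `8 * a * (1 + log m)` is at most `64 * 4 = 256` times `a ^ 2 * (1 + log m ^ 3)`.
  have hsq : (1 + Real.log m) ^ 2 ≤ 4 * (1 + Real.log m ^ 3) := by
    nlinarith [mul_nonneg hl (sq_nonneg (Real.log m - 1)), sq_nonneg (Real.log m - 1)]
  rw [div_le_iff₀ (Real.sqrt_pos.2 hm')]
  refine abs_le_of_sq_le_sq' ?_ (by positivity) |>.2
  rw [mul_pow, mul_pow ε, Real.sq_sqrt hm'.le]
  rw [← mul_div_assoc, div_le_iff₀ (by positivity)] at h
  have := mul_le_mul_of_nonneg_left hsq (by positivity : 0 ≤ 64 * a ^ 2)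
  nlinarith

theorem one_add_log_cube_le {x : ℝ} (hx : 1 ≤ x) : 1 + Real.log x ^ 3 ≤ 217 * √x := by
  have hx0 : 0 < x := by linarith
  have h1 := Real.log_le_rpow_div hx0.le (by norm_num : (0 : ℝ) < 1 / 6)
  have h2 : Real.log x ^ 3 ≤ (x ^ (1 / 6 : ℝ) / (1 / 6)) ^ 3 :=
    pow_le_pow_left₀ (Real.log_nonneg hx) h1 3
  have h3 : (x ^ (1 / 6 : ℝ)) ^ 3 = √x := by
    rw [Real.sqrt_eq_rpow, ← Real.rpow_natCast, ← Real.rpow_mul hx0.le]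
    norm_num
  have h4 : (x ^ (1 / 6 : ℝ) / (1 / 6)) ^ 3 = 216 * √x := by
    rw [← h3]; ring
  have h5 : 1 ≤ √x := Real.one_le_sqrt.2 hx
  linarith

/-- The implicit condition on the sample size follows from an explicit one. -/
theorem exists_const_sample_size {c : ℝ} (hc : 0 < c) :
    ∃ C : ℝ, 0 < C ∧ ∀ K x : ℝ, 0 ≤ K → 1 ≤ x →
      C * (K * (1 + Real.log (1 + K) ^ 3)) ≤ x → c * (K * (1 + Real.log x ^ 3)) ≤ x := by
  -- If `x > A * (1 + K) ^ 2`, then `217 * c * K ≤ √x` and the crude bound on the logarithm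
  -- suffices. Otherwise `log x ≤ log A + 2 * log (1 + K)`; cubing with `(p + q) ^ 3 ≤ 4 * (p ^ 3 +
  -- q ^ 3)` gives `33 = 1 + 4 * 8`.
  set A : ℝ := 1 + (217 * c) ^ 2 with hA
  have hA1 : 1 ≤ A := by have := sq_nonneg (217 * c); linarith
  have hlA : 0 ≤ Real.log A := Real.log_nonneg hA1
  refine ⟨c * (33 + 4 * Real.log A ^ 3), by positivity, fun K x hK hx h => ?_⟩
  have hx0 : 0 < x := by linarith
  have hlK : 0 ≤ Real.log (1 + K) := Real.log_nonneg (by linarith)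
  have hlx : 0 ≤ Real.log x := Real.log_nonneg hx
  rcases le_or_gt x (A * (1 + K) ^ 2) with hle | hgt
  · refine le_trans ?_ h
    have h1 : Real.log x ≤ Real.log A + 2 * Real.log (1 + K) := by
      have := Real.log_le_log hx0 hle
      rwa [Real.log_mul (by positivity) (by positivity), Real.log_pow] at this
    have h2 : Real.log x ^ 3 ≤ (Real.log A + 2 * Real.log (1 + K)) ^ 3 :=
      pow_le_pow_left₀ hlx h1 3
    have h3 := add_pow_le hlA (by positivity : 0 ≤ 2 * Real.log (1 + K)) 3
    have h4 : 0 ≤ Real.log A ^ 3 * Real.log (1 + K) ^ 3 := by positivity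
    have h5 : 0 ≤ Real.log (1 + K) ^ 3 := by positivity
    have h6 : 1 + Real.log x ^ 3
        ≤ (33 + 4 * Real.log A ^ 3) * (1 + Real.log (1 + K) ^ 3) := by
      norm_num at h3
      rw [mul_pow] at h3
      nlinarith
    have := mul_le_mul_of_nonneg_left h6 (mul_nonneg hc.le hK)
    linarith
  · have h1 := one_add_log_cube_le hx
    have h2 : 217 * c * K ≤ √x := by
      refine Real.le_sqrt_of_sq_le ?_
      refine le_trans ?_ hgt.le
      rw [mul_pow]
      have : K ^ 2 ≤ (1 + K) ^ 2 := by gcongr; linarith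
      exact mul_le_mul (by linarith) this (by positivity) (by positivity)
    calc c * (K * (1 + Real.log x ^ 3)) ≤ c * (K * (217 * √x)) := by gcongr
      _ = 217 * c * K * √x := by ring
      _ ≤ √x * √x := by gcongr
      _ = x := Real.mul_self_sqrt hx0.le

/-- The first part is the bound under the implicit condition on `m`; the second part makes explicit
that `m` of order `K = (b B b_x L / ε)²`, up to a factor polylogarithmic in `K`, suffices. -/
theorem theorem2 :
    (∃ c : ℝ, 0 < c ∧
      ∀ (σ : ℝ → ℝ) (L : ℝ≥0), LipschitzWith L σ → σ 0 = 0 →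
      ∀ (b B bx ε : ℝ), 0 < b → 0 < B → 0 < bx → 0 < ε →
      ∀ (n d m : ℕ), 0 < n → 0 < d → 0 < m →
        c * ((b * B * bx * L) ^ 2 * (1 + Real.log m ^ 3) / ε ^ 2) ≤ (m : ℝ) →
        rademacherComplexity m {x : EuclideanSpace ℝ (Fin d) | ‖x‖ ≤ bx}
          (frobeniusClass σ b B n d) ≤ (ε : EReal)) ∧
    (∃ C : ℝ, 0 < C ∧
      ∀ (σ : ℝ → ℝ) (L : ℝ≥0), LipschitzWith L σ → σ 0 = 0 →
      ∀ (b B bx ε : ℝ), 0 < b → 0 < B → 0 < bx → 0 < ε →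
      ∀ (n d m : ℕ), 0 < n → 0 < d → 0 < m →
        C * ((b * B * bx * L / ε) ^ 2 * (1 + Real.log (1 + (b * B * bx * L / ε) ^ 2) ^ 3))
          ≤ (m : ℝ) →
        rademacherComplexity m {x : EuclideanSpace ℝ (Fin d) | ‖x‖ ≤ bx}
          (frobeniusClass σ b B n d) ≤ (ε : EReal)) := by
  have implicit_bound : ∀ (σ : ℝ → ℝ) (L : ℝ≥0), LipschitzWith L σ → σ 0 = 0 →
      ∀ (b B bx ε : ℝ), 0 < b → 0 < B → 0 < bx → 0 < ε →
      ∀ (n d m : ℕ), 0 < n → 0 < d → 0 < m →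
        256 * ((b * B * bx * L) ^ 2 * (1 + Real.log m ^ 3) / ε ^ 2) ≤ (m : ℝ) →
        rademacherComplexity m {x : EuclideanSpace ℝ (Fin d) | ‖x‖ ≤ bx}
          (frobeniusClass σ b B n d) ≤ (ε : EReal) := by
    intro σ L hσ h0 b B bx ε hb hB hbx hε n d m _ _ hm h
    refine (rademacherComplexity_frobeniusClass_le hσ h0 hb hB hbx n d hm).trans ?_
    rw [EReal.coe_le_coe_iff]
    exact mul_div_sqrt_le hε hm h
  refine ⟨⟨256, by norm_num, implicit_bound⟩, ?_⟩
  obtain ⟨C, hC, hCK⟩ := exists_const_sample_size (c := 256) (by norm_num)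
  refine ⟨C, hC, fun σ L hσ h0 b B bx ε hb hB hbx hε n d m hn hd hm h => ?_⟩
  refine implicit_bound σ L hσ h0 b B bx ε hb hB hbx hε n d m hn hd hm ?_
  have := hCK _ m (sq_nonneg _) (by exact_mod_cast hm) h
  rwa [div_pow, div_mul_eq_mul_div] at this
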